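/- Let $X$ be a Tychonoff space, and let $B_1(X)$ be the real vector space of all Baire-one functions on $X$, that is, of all functions $f\colon X\to\mathbb{R}$ that are pointwise limits of sequences of continuous real-valued functions on $X$, endowed with the pointwise topology (the topology induced from the product $\mathbb{R}^X$). Suppose that $B_1(X)$ is locally complete, i.e. for every sequence in $B_1(X)$ that converges to $0$, its closed absolutely convex hull in $B_1(X)$ is compact. Then $B_1(X)$ is a Choquet space, and hence a Baire space. Here a topological space $Y$ is called a Choquet space if player N has a winning strategy in the following game of two players E and N: they alternately choose nonempty open sets $U_0\supseteq V_0\supseteq U_1\supseteq V_1\supseteq\cdots$ of $Y$, where E chooses the sets $U_n$ and N chooses the sets $V_n$, and N wins if $\bigcap_{n} U_n\neq\emptyset$. The space $Y$ is a Baire space if every countable intersection of dense open subsets of $Y$ is dense in $Y$. -/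

import Mathlib

open Filter Topology

/-- The real vector space `B₁(X)` of Baire-one functions on `X`: all functions `X → ℝ` that are
pointwise limits of sequences of continuous real-valued functions. As a subspace of `X → ℝ`, which
carries the product topology, it is endowed with the pointwise topology. -/
def BaireOne (X : Type*) [TopologicalSpace X] : Submodule ℝ (X → ℝ) where
  carrier := {f | ∃ F : ℕ → X → ℝ, (∀ n, Continuous (F n)) ∧
    ∀ x, Tendsto (fun n => F n x) atTop (𝓝 (f x))}
  zero_mem' := ⟨fun _ _ => 0, fun _ => continuous_const, fun _ => tendsto_const_nhds⟩
  add_mem' := by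
    rintro f g ⟨F, hF, hf⟩ ⟨G, hG, hg⟩
    exact ⟨fun n x => F n x + G n x, fun n => (hF n).add (hG n), fun x => (hf x).add (hg x)⟩
  smul_mem' := by
    rintro c f ⟨F, hF, hf⟩
    exact ⟨fun n x => c * F n x, fun n => continuous_const.mul (hF n),
      fun x => (hf x).const_mul c⟩

/-- A (Hausdorff) real locally convex space is *locally complete* if the closed absolutely convex
hull of every sequence converging to zero is compact. -/
def IsLocallyComplete (E : Type*) [AddCommGroup E] [Module ℝ E] [TopologicalSpace E] : Prop :=
  ∀ g : ℕ → E, Tendsto g atTop (𝓝 0) → IsCompact (closedAbsConvexHull ℝ (Set.range g))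

namespace ChoquetGame

/-! In the Choquet game on a space `Y`, player E (Empty) and player N (Nonempty) alternately choose
nonempty open sets `U₀ ⊇ V₀ ⊇ U₁ ⊇ V₁ ⊇ ⋯`, where the sets `Uₙ` are chosen by E and the sets `Vₙ`
by N. Player N wins the run if the intersection of all the sets `Uₙ` is nonempty. -/

variable {Y : Type*}

/-- The list `[U₀, …, Uₙ]` of the first `n + 1` moves of player E. -/
def history (U : ℕ → Set Y) (n : ℕ) : List (Set Y) := (List.range (n + 1)).map U

/-- The moves `U₀, …, Uₙ` of player E are legal when player N answers `U₀, …, Uₖ` by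
`σ [U₀, …, Uₖ]`: they are nonempty open sets, and each move after the first is contained in
the preceding answer of player N. -/
def LegalUpTo [TopologicalSpace Y] (σ : List (Set Y) → Set Y) (U : ℕ → Set Y) (n : ℕ) : Prop :=
  (∀ k ≤ n, IsOpen (U k) ∧ (U k).Nonempty) ∧ ∀ k < n, U (k + 1) ⊆ σ (history U k)

/-- `σ` is a winning strategy of player N: against legal moves of E it always answers by a nonempty
open subset of the last move of E, and N wins every infinite run played according to `σ`. -/
structure IsWinningStrategy [TopologicalSpace Y] (σ : List (Set Y) → Set Y) : Prop where
  isOpen : ∀ U n, LegalUpTo σ U n → IsOpen (σ (history U n))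
  nonempty : ∀ U n, LegalUpTo σ U n → (σ (history U n)).Nonempty
  subset : ∀ U n, LegalUpTo σ U n → σ (history U n) ⊆ U n
  wins : ∀ U, (∀ n, LegalUpTo σ U n) → (⋂ n, U n).Nonempty

end ChoquetGame

/-- A *Choquet space*: player N (Nonempty) has a winning strategy in the Choquet game. -/
def IsChoquetSpace (Y : Type*) [TopologicalSpace Y] : Prop :=
  ∃ σ : List (Set Y) → Set Y, ChoquetGame.IsWinningStrategy σ

/-! Local completeness makes every function on a countable set `D` extend to a Baire-one function:
the points of `D` lie in disjoint zero sets, multiples of their indicators are Baire-one, and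
`BaireOne.mem_of_tendsto_sum` sums them. In the game, N answers with a box restricting finitely many
coordinates. A run restricts only countably many, compactness of closed intervals gives admissible
values there, and an extension of these values lies in every `U n`. -/

section PointFiniteSums

/-- A convex set containing `0` contains the finite sums `∑ 2⁻⁽ⁿ⁺¹⁾ xₙ` of its points. -/
lemma Convex.sum_half_pow_smul_mem {E : Type*} [AddCommGroup E] [Module ℝ E] {C : Set E}
    (hC : Convex ℝ C) (h0 : (0 : E) ∈ C) (N : ℕ) :
    ∀ g : ℕ → E, (∀ n, g n ∈ C) → ∑ n ∈ Finset.range N, ((1 / 2 : ℝ) ^ (n + 1)) • g n ∈ C := by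
  induction N with
  | zero => intro g _; simpa using h0
  | succ N ih =>
    intro g hg
    have hmem := hC (hg 0) (ih (fun n => g (n + 1)) fun n => hg (n + 1))
      (show (0 : ℝ) ≤ 1 / 2 by norm_num) (show (0 : ℝ) ≤ 1 / 2 by norm_num) (by norm_num)
    rw [Finset.sum_range_succ', add_comm]
    convert hmem using 2
    · norm_num
    · rw [Finset.smul_sum]
      exact Finset.sum_congr rfl fun n _ => by rw [smul_smul, pow_succ' _ (n + 1)]

/-- In a locally complete space `B₁(X)`, the limit of the partial sums of a point-finite sequence
of Baire-one functions is Baire-one. -/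
lemma BaireOne.mem_of_tendsto_sum {X : Type*} [TopologicalSpace X]
    (h : IsLocallyComplete (BaireOne X)) (g : ℕ → BaireOne X)
    (hg : ∀ x, ∀ᶠ n in atTop, (g n : X → ℝ) x = 0) {f : X → ℝ}
    (hf : ∀ x, Tendsto (fun N => ∑ n ∈ Finset.range N, (g n : X → ℝ) x) atTop (𝓝 (f x))) :
    f ∈ BaireOne X := by
  -- Point-finiteness makes `G` tend to `0` despite the factors, while the partial sums of `g` carry
  -- weights `2⁻⁽ⁿ⁺¹⁾` over `G` and so stay in its hull.
  set G : ℕ → BaireOne X := fun n => ((2 : ℝ) ^ (n + 1)) • g n with hG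
  have hG0 : Tendsto G atTop (𝓝 0) := by
    rw [tendsto_subtype_rng, tendsto_pi_nhds]
    intro x
    refine tendsto_const_nhds.congr' ?_
    filter_upwards [hg x] with n hn
    simp [hG, hn]
  have hK := (h G hG0).image continuous_subtype_val
  have hconv : Convex ℝ (closedAbsConvexHull ℝ (Set.range G)) :=
    (absConvex_convexClosedHull (𝕜 := ℝ) (s := Set.range G)).2
  have hbal : Balanced ℝ (closedAbsConvexHull ℝ (Set.range G)) :=
    (absConvex_convexClosedHull (𝕜 := ℝ) (s := Set.range G)).1
  have hsub : Set.range G ⊆ closedAbsConvexHull ℝ (Set.range G) := subset_closedAbsConvexHull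
  have hmem : ∀ n, G n ∈ closedAbsConvexHull ℝ (Set.range G) := fun n => hsub ⟨n, rfl⟩
  have h0 : (0 : BaireOne X) ∈ closedAbsConvexHull ℝ (Set.range G) :=
    hbal.zero_mem ⟨_, hmem 0⟩
  have hS : ∀ N, ∑ n ∈ Finset.range N, g n ∈ closedAbsConvexHull ℝ (Set.range G) := by
    intro N
    convert hconv.sum_half_pow_smul_mem h0 N G hmem using 2 with n
    simp only [hG, smul_smul, ← mul_pow]
    norm_num
  have hlim : Tendsto (fun N => ((∑ n ∈ Finset.range N, g n : BaireOne X) : X → ℝ)) atTop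
      (𝓝 f) := by
    rw [tendsto_pi_nhds]
    intro x
    simpa using hf x
  -- Compactness makes the hull closed in all of `X → ℝ`, not only in `B₁(X)`.
  obtain ⟨k, -, rfl⟩ := hK.isClosed.mem_of_tendsto hlim
    (Eventually.of_forall fun N => ⟨_, hS N, rfl⟩)
  exact k.2

end PointFiniteSums

section Extension

/-- Multiples of the indicator of a zero set are Baire-one. -/
lemma BaireOne.indicator_zeroSet_mem {X : Type*} [TopologicalSpace X] {v : X → ℝ}
    (hv : Continuous v) (c : ℝ) : {x | v x = 0}.indicator (fun _ => c) ∈ BaireOne X := by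
  refine ⟨fun n x => c / (1 + n * v x ^ 2), fun n => ?_, fun x => ?_⟩
  · exact continuous_const.div (by fun_prop) fun x => by positivity
  · by_cases hx : v x = 0
    · simp [hx]
    · rw [Set.indicator_of_notMem (by exact hx)]
      refine Tendsto.const_div_atTop ?_ c
      exact tendsto_atTop_add_const_left _ _
        (tendsto_natCast_atTop_atTop.atTop_mul_const (by positivity))

/-- The points of a countable set in a Tychonoff space lie in pairwise disjoint zero sets. -/
lemma exists_continuous_disjoint_zeroSets {X : Type*} [TopologicalSpace X] [T35Space X]
    {D : Set X} (hD : D.Countable) : ∃ v : D → X → ℝ, (∀ d, Continuous (v d)) ∧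
      (∀ d, v d d = 0) ∧ ∀ x d e, v d x = 0 → v e x = 0 → d = e := by
  have := hD.to_subtype
  have hsep : ∀ p : D × D, ∃ u : X → ℝ, Continuous u ∧ (p.1 ≠ p.2 → u p.1 ≠ u p.2) := by
    rintro ⟨d, e⟩
    by_cases hde : d = e
    · exact ⟨0, continuous_zero, fun hne => (hne hde).elim⟩
    · obtain ⟨u, hu, hu0, hu1⟩ := CompletelyRegularSpace.completely_regular (d : X) {(e : X)}
        isClosed_singleton (by simpa [Subtype.ext_iff] using hde)
      refine ⟨fun x => u x, by fun_prop, fun _ => ?_⟩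
      have hu1' := hu1 (Set.mem_singleton (e : X))
      simp [hu0, hu1']
  choose u hu hsep using hsep
  -- `Φ` is injective on `D` with values in a metrizable space, so the fibres of `Φ` through points
  -- of `D` are disjoint zero sets.
  let Φ : X → D × D → ℝ := fun x p => u p x
  have hΦ : Continuous Φ := continuous_pi hu
  let := TopologicalSpace.metrizableSpaceMetric (D × D → ℝ)
  refine ⟨fun d x => dist (Φ x) (Φ d), fun d => hΦ.dist continuous_const, fun d => dist_self _,
    fun x d e hd he => ?_⟩
  by_contra hne
  have hΦde : Φ d = Φ e := (dist_eq_zero.1 hd).symm.trans (dist_eq_zero.1 he)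
  exact hsep (d, e) hne (congrFun hΦde (d, e))

/-- If `B₁(X)` is locally complete, every function on a countable subset of `X` extends to a
Baire-one function on `X`. -/
lemma BaireOne.exists_eqOn_of_countable {X : Type*} [TopologicalSpace X] [T35Space X]
    (h : IsLocallyComplete (BaireOne X)) {D : Set X} (hD : D.Countable) (f : X → ℝ) :
    ∃ g : BaireOne X, Set.EqOn g f D := by
  classical
  obtain ⟨v, hv, hv0, hdisj⟩ := exists_continuous_disjoint_zeroSets hD
  have := hD.to_subtype
  obtain ⟨code, hcode⟩ := exists_injective_nat D
  let g : ℕ → BaireOne X := fun n =>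
    if hn : ∃ d, code d = n then ⟨_, indicator_zeroSet_mem (hv hn.choose) (f hn.choose)⟩ else 0
  have hg : ∀ n x, (g n : X → ℝ) x ≠ 0 → ∃ d, code d = n ∧ v d x = 0 := by
    intro n x hx
    by_cases hn : ∃ d, code d = n
    · simp only [g, dif_pos hn] at hx
      exact ⟨hn.choose, hn.choose_spec,
        Set.mem_of_indicator_ne_zero (s := {x | v hn.choose x = 0}) hx⟩
    · simp only [g, dif_neg hn] at hx
      exact (hx rfl).elim
  have hsum : ∀ x d, v d x = 0 → ∀ n, n ≠ code d → (g n : X → ℝ) x = 0 := by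
    intro x d hd n hn
    by_contra hne
    obtain ⟨e, rfl, he⟩ := hg n x hne
    exact hn (congrArg code (hdisj x e d he hd))
  have hval : ∀ d : D, (g (code d) : X → ℝ) d = f d := by
    intro d
    have hn : ∃ e, code e = code d := ⟨d, rfl⟩
    have hd : hn.choose = d := hcode hn.choose_spec
    simp only [g, dif_pos hn]
    rw [hd]
    exact Set.indicator_of_mem (s := {x | v d x = 0}) (hv0 d) _
  have hfin : ∀ x, ∃ m, ∀ n, n ≠ m → (g n : X → ℝ) x = 0 := by
    intro x
    by_cases hx : ∃ d, v d x = 0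
    · obtain ⟨d, hd⟩ := hx
      exact ⟨code d, hsum x d hd⟩
    -- Off all the zero sets every `g n` vanishes at `x`, so any index serves.
    · refine ⟨0, fun n _ => by_contra fun hne => hx ?_⟩
      obtain ⟨d, -, hd⟩ := hg n x hne
      exact ⟨d, hd⟩
  choose m hm using hfin
  refine ⟨⟨fun x => (g (m x) : X → ℝ) x, mem_of_tendsto_sum h g ?_ ?_⟩, ?_⟩
  · intro x
    filter_upwards [eventually_gt_atTop (m x)] with n hn using hm x n hn.ne'
  · intro x
    refine (hasSum_single (m x) (hm x)).tendsto_sum_nat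
  · intro x hx
    change (g (m x) : X → ℝ) x = f x
    rw [← hval ⟨x, hx⟩]
    by_cases hc : code ⟨x, hx⟩ = m x
    · rw [hc]
    · rw [hm x _ hc]
      exact hsum x ⟨x, hx⟩ (hv0 _) _ (Ne.symm hc)

end Extension

/-! ### The Choquet game and Baire category -/

namespace ChoquetGame

variable {Y : Type*}

lemma history_succ (U : ℕ → Set Y) (n : ℕ) :
    history U (n + 1) = history U n ++ [U (n + 1)] := by
  simp [history, List.range_succ (n := n + 1)]

lemma getLast?_history (U : ℕ → Set Y) (n : ℕ) : (history U n).getLast? = some (U n) := by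
  simp [history, List.range_succ]

/-- The histories of the run in which E starts with `W ∩ D 0` and answers the `n`-th move
`V` of N by `V ∩ D (n + 1)`. -/
def denseHistory (σ : List (Set Y) → Set Y) (W : Set Y) (D : ℕ → Set Y) : ℕ → List (Set Y)
  | 0 => [W ∩ D 0]
  | n + 1 => denseHistory σ W D n ++ [σ (denseHistory σ W D n) ∩ D (n + 1)]

/-- The moves of E in the run with histories `denseHistory`. -/
def denseMove (σ : List (Set Y) → Set Y) (W : Set Y) (D : ℕ → Set Y) : ℕ → Set Y
  | 0 => W ∩ D 0
  | n + 1 => σ (denseHistory σ W D n) ∩ D (n + 1)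

lemma history_denseMove (σ : List (Set Y) → Set Y) (W : Set Y) (D : ℕ → Set Y) (n : ℕ) :
    history (denseMove σ W D) n = denseHistory σ W D n := by
  induction n with
  | zero => rfl
  | succ n ih => rw [history_succ, ih]; rfl

/-- A stationary strategy wins if it answers `U` by `V U` and wins every descending run. -/
lemma isWinningStrategy_stationary [TopologicalSpace Y] (V : Set Y → Set Y)
    (hV : ∀ U, IsOpen U → U.Nonempty → IsOpen (V U) ∧ (V U).Nonempty ∧ V U ⊆ U)
    (hwin : ∀ U : ℕ → Set Y, (∀ n, IsOpen (U n) ∧ (U n).Nonempty) →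
      (∀ n, U (n + 1) ⊆ V (U n)) → (⋂ n, U n).Nonempty) :
    IsWinningStrategy fun L : List (Set Y) => V (L.getLast?.getD ∅) := by
  -- Histories are nonempty, so the default `∅` is never used.
  have key : ∀ (U : ℕ → Set Y) n, (history U n).getLast?.getD ∅ = U n := fun U n => by
    rw [getLast?_history, Option.getD_some]
  refine ⟨fun U n hU => ?_, fun U n hU => ?_, fun U n hU => ?_, fun U hU => ?_⟩
  · simpa only [key] using (hV _ (hU.1 n le_rfl).1 (hU.1 n le_rfl).2).1
  · simpa only [key] using (hV _ (hU.1 n le_rfl).1 (hU.1 n le_rfl).2).2.1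
  · simpa only [key] using (hV _ (hU.1 n le_rfl).1 (hU.1 n le_rfl).2).2.2
  · refine hwin U (fun n => (hU n).1 n le_rfl) fun n => ?_
    simpa only [key] using (hU (n + 1)).2 n n.lt_succ_self

end ChoquetGame

open ChoquetGame in
/-- Choquet spaces are Baire spaces. -/
lemma IsChoquetSpace.baireSpace {Y : Type*} [TopologicalSpace Y] (hY : IsChoquetSpace Y) :
    BaireSpace Y := by
  obtain ⟨σ, hσ⟩ := hY
  refine ⟨fun D hDo hDd => dense_iff_inter_open.2 fun W hWo hWne => ?_⟩
  have hlegal : ∀ n, LegalUpTo σ (denseMove σ W D) n := by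
    intro n
    induction n with
    | zero =>
      refine ⟨fun k hk => ?_, fun k hk => absurd hk k.not_lt_zero⟩
      obtain rfl := Nat.le_zero.1 hk
      exact ⟨hWo.inter (hDo 0), (hDd 0).inter_open_nonempty W hWo hWne⟩
    | succ n ih =>
      have ho := hσ.isOpen _ n ih
      have hne := hσ.nonempty _ n ih
      rw [history_denseMove] at ho hne
      refine ⟨fun k hk => ?_, fun k hk => ?_⟩
      · rcases hk.lt_or_eq with hk | rfl
        · exact ih.1 k (Nat.lt_succ_iff.1 hk)
        · exact ⟨ho.inter (hDo _), (hDd _).inter_open_nonempty _ ho hne⟩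
      · rw [history_denseMove]
        exact Set.inter_subset_left
  obtain ⟨y, hy⟩ := hσ.wins _ hlegal
  rw [Set.mem_iInter] at hy
  refine ⟨y, (hy 0).1, Set.mem_iInter.2 fun n => ?_⟩
  cases n with
  | zero => exact (hy 0).2
  | succ n => exact (hy (n + 1)).2

/-! ### The game on `B₁(X)` -/

/-- Every nonempty open set of `B₁(X)` contains a closed box of positive widths on a finite set. -/
lemma BaireOne.exists_closedBox_subset {X : Type*} [TopologicalSpace X] {U : Set (BaireOne X)}
    (hU : IsOpen U) (hne : U.Nonempty) : ∃ (f : BaireOne X) (I : Finset X) (δ : X → ℝ),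
      (∀ x, 0 < δ x) ∧
      ∀ g : BaireOne X, (∀ x ∈ I, (g : X → ℝ) x ∈ Metric.closedBall ((f : X → ℝ) x) (δ x)) →
        g ∈ U := by
  obtain ⟨f, hf⟩ := hne
  obtain ⟨O, hO, rfl⟩ := isOpen_induced_iff.1 hU
  obtain ⟨I, u, hu, hsub⟩ := isOpen_pi_iff.1 hO f hf
  have hδ : ∀ x, ∃ δ : ℝ, 0 < δ ∧ (x ∈ I → Metric.closedBall ((f : X → ℝ) x) δ ⊆ u x) := by
    intro x
    by_cases hx : x ∈ I
    · obtain ⟨δ, hδ, hsub⟩ := Metric.nhds_basis_closedBall.mem_iff.1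
        ((hu x hx).1.mem_nhds (hu x hx).2)
      exact ⟨δ, hδ, fun _ => hsub⟩
    · exact ⟨1, one_pos, fun h => (hx h).elim⟩
  choose δ hδ hball using hδ
  exact ⟨f, I, δ, hδ, fun g hg => hsub fun x hx => hball x hx (hg x hx)⟩

/-- If all functions on countable subsets of `X` extend to Baire-one functions, then `B₁(X)` is a
Choquet space. -/
lemma BaireOne.isChoquetSpace_of_exists_eqOn {X : Type*} [TopologicalSpace X]
    (hext : ∀ (D : Set X), D.Countable → ∀ f : X → ℝ, ∃ g : BaireOne X, Set.EqOn g f D) :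
    IsChoquetSpace (BaireOne X) := by
  have hbox : ∀ U : Set (BaireOne X), ∃ (f : BaireOne X) (I : Finset X) (δ : X → ℝ),
      IsOpen U → U.Nonempty → (∀ x, 0 < δ x) ∧
      ∀ g : BaireOne X, (∀ x ∈ I, (g : X → ℝ) x ∈ Metric.closedBall ((f : X → ℝ) x) (δ x)) →
        g ∈ U := by
    intro U
    by_cases hU : IsOpen U ∧ U.Nonempty
    · obtain ⟨f, I, δ, hfI⟩ := exists_closedBox_subset hU.1 hU.2
      exact ⟨f, I, δ, fun _ _ => hfI⟩
    · exact ⟨0, ∅, 0, fun h₁ h₂ => (hU ⟨h₁, h₂⟩).elim⟩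
  choose f I δ hbox using hbox
  -- Open balls keep the answer open; the closed balls still lie in `U`, so limits do not escape.
  let V : Set (BaireOne X) → Set (BaireOne X) := fun U =>
    {g | ∀ x ∈ I U, (g : X → ℝ) x ∈ Metric.ball ((f U : X → ℝ) x) (δ U x)}
  have hfV : ∀ U, IsOpen U → U.Nonempty → f U ∈ V U := fun U ho hne x _ =>
    Metric.mem_ball_self ((hbox U ho hne).1 x)
  have hVU : ∀ U, IsOpen U → U.Nonempty → V U ⊆ U := fun U ho hne g hg =>
    (hbox U ho hne).2 g fun x hx => Metric.ball_subset_closedBall (hg x hx)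
  refine ⟨_, ChoquetGame.isWinningStrategy_stationary V (fun U ho hne => ⟨?_, ⟨_, hfV U ho hne⟩,
    hVU U ho hne⟩) fun U hU hdesc => ?_⟩
  · have hV : V U = ⋂ x ∈ I U, (fun g : BaireOne X => (g : X → ℝ) x) ⁻¹'
        Metric.ball ((f U : X → ℝ) x) (δ U x) := by
      ext g
      simp [V]
    rw [hV]
    exact isOpen_biInter_finset fun x _ =>
      Metric.isOpen_ball.preimage ((continuous_apply x).comp continuous_subtype_val)
  · have hanti : Antitone U := antitone_nat_of_succ_le fun n =>
      (hdesc n).trans (hVU _ (hU n).1 (hU n).2)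
    -- All later centres `f (U k)` lie in the `n`-th box, so at each `x` one ultrafilter limit
    -- satisfies every constraint imposed there.
    have hmem : ∀ n, ∀ x ∈ I (U n), ∀ᶠ k in (hyperfilter ℕ : Filter ℕ),
        (f (U k) : X → ℝ) x ∈ Metric.closedBall ((f (U n) : X → ℝ) x) (δ (U n) x) := by
      intro n x hx
      have hev : ∀ᶠ k in (hyperfilter ℕ : Filter ℕ), n + 1 ≤ k :=
        Nat.hyperfilter_le_atTop (eventually_ge_atTop (n + 1))
      filter_upwards [hev] with k hk
      have hfk : f (U k) ∈ U k := hVU _ (hU k).1 (hU k).2 (hfV _ (hU k).1 (hU k).2)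
      exact Metric.ball_subset_closedBall (hdesc n (hanti hk hfk) x hx)
    have hlim : ∀ x, ∃ y : ℝ, ∀ n, x ∈ I (U n) →
        y ∈ Metric.closedBall ((f (U n) : X → ℝ) x) (δ (U n) x) := by
      intro x
      by_cases hx : ∃ n, x ∈ I (U n)
      · obtain ⟨n, hn⟩ := hx
        obtain ⟨y, -, hy⟩ := (isCompact_closedBall _ _).ultrafilter_le_nhds'
          ((hyperfilter ℕ).map fun k => (f (U k) : X → ℝ) x) (hmem n x hn)
        exact ⟨y, fun m hm => Metric.isClosed_closedBall.mem_of_tendsto (f := fun k =>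
          (f (U k) : X → ℝ) x) (b := (hyperfilter ℕ : Filter ℕ)) hy (hmem m x hm)⟩
      · exact ⟨0, fun n hn => (hx ⟨n, hn⟩).elim⟩
    choose l hl using hlim
    obtain ⟨g, hg⟩ := hext (⋃ n, (I (U n) : Set X))
      (Set.countable_iUnion fun n => (I (U n)).countable_toSet) l
    refine ⟨g, Set.mem_iInter.2 fun n => (hbox _ (hU n).1 (hU n).2).2 g fun x hx => ?_⟩
    rw [hg (Set.mem_iUnion.2 ⟨n, hx⟩)]
    exact hl x n hx

theorem corollary3p7 (X : Type*) [TopologicalSpace X] [T35Space X]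
    (h : IsLocallyComplete (BaireOne X)) :
    IsChoquetSpace (BaireOne X) ∧ BaireSpace (BaireOne X) := by
  have hC : IsChoquetSpace (BaireOne X) :=
    BaireOne.isChoquetSpace_of_exists_eqOn fun _ hD f => BaireOne.exists_eqOn_of_countable h hD f
  exact ⟨hC, hC.baireSpace⟩
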